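/- Let $\sigma$ be a finite relational signature (a finite set of relation symbols of positive arities), and let first-order formulas over $\sigma$ be built from atoms $x=y$ and $R(x_1,\dots,x_k)$ by $\neg\varphi$, $(\varphi\vee\psi)$ and $\exists y\,\varphi$; the size $\|\varphi\|$ is the length of $\varphi$ as a word whose letters are the relation symbols, the variables, the comma, the parentheses and $=,\neg,\vee,\exists$. A formula (not necessarily in prenex form) is in $\Sigma_n$ if it has quantifier alternation depth at most $n$ with existential outermost quantifier block. That is: let $\Sigma_0=\Pi_0$ be the set of quantifier-free formulas, and for $n\ge1$ let $\Sigma_n$ and $\Pi_n$ be the smallest sets that contain $\Sigma_{n-1}\cup\Pi_{n-1}$, are closed under disjunction, and satisfy: $\varphi\in\Sigma_n$ implies $\exists y\,\varphi\in\Sigma_n$ and $\neg\varphi\in\Pi_n$, and $\varphi\in\Pi_n$ implies $\neg\varphi\in\Sigma_n$. All structures are finite and non-empty. The Gaifman graph of a $\sigma$-structure $\mathcal A$ with universe $A$ has vertex set $A$ and an edge between any two distinct elements that occur together in a tuple of some relation of $\mathcal A$. For a tuple $\bar a$ over $A$ and $r\in\mathbb N$, the $r$-sphere $\mathcal N_r^{\mathcal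 A}(\bar a)$ is the substructure of $\mathcal A$ induced on the set of elements at Gaifman distance at most $r$ from some entry of $\bar a$, together with the tuple $\bar a$ of distinguished elements. For $\sigma$-structures $\mathcal A,\mathcal B$ and $\bar a\in A^m$, $\bar b\in B^m$, write $(\mathcal A,\bar a)\leftrightharpoons_r(\mathcal B,\bar b)$ if there is a bijection $f\colon A\to B$ such that $\mathcal N_r^{\mathcal A}(\bar a,c)\cong\mathcal N_r^{\mathcal B}(\bar b,f(c))$ for all $c\in A$. A formula $\varphi(\bar x)$ with $\bar x=(x_1,\dots,x_m)$ pairwise distinct variables, among which are all free variables of $\varphi$, is Hanf-local if there is $r\in\mathbb N$ such that for all $\sigma$-structures $\mathcal A,\mathcal B$ and all $\bar a\in A^m$, $\bar b\in B^m$ with $(\mathcal A,\bar a)\leftrightharpoons_r(\mathcal B,\bar b)$ we have $\mathcal A\models\varphi[\bar a]\iff\mathcal B\models\varphi[\bar b]$; the least such $r$ is the Hanf-locality rank $\operatorname{lr}(\varphi)$. Theorem. Let $n\ge0$, and let $\varphi(\bar x)$ be a first-order formula over $\sigma$ in $\Sigma_n$, with $m=|\bar x|>0$. Then $\varphi(\bar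 x)$ is Hanf-local, and $\operatorname{lr}(\varphi)<(2\|\varphi\|+1)^n$. In particular, for each fixed $n$ this bounds the locality rank of $\Sigma_n$-formulas by a polynomial of degree $n$ in the formula size. -/

import Mathlib

universe u v

namespace HanfLocality

open scoped FirstOrder

/-- First-order formulas over a relational signature `L`, with the natural numbers as the countably
infinite set of variables. The primitive connectives are negation, disjunction and the
existential quantifier. -/
inductive FOFormula (L : FirstOrder.Language.{u, v}) : Type v
  /-- the equation `x = y` -/
  | eq (x y : ℕ) : FOFormula L
  /-- the atom `R(x₁, …, xₖ)` -/
  | rel {k : ℕ} (R : L.Relations k) (x : Fin k → ℕ) : FOFormula L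
  /-- the negation `¬ φ` -/
  | neg (φ : FOFormula L) : FOFormula L
  /-- the disjunction `(φ ∨ ψ)` -/
  | or (φ ψ : FOFormula L) : FOFormula L
  /-- the quantification `∃ y φ` -/
  | ex (y : ℕ) (φ : FOFormula L) : FOFormula L

namespace FOFormula

variable {L : FirstOrder.Language.{u, v}}

/-- Truth of a formula in a structure under an assignment of the variables. -/
def Realize {A : Type*} [L.Structure A] : FOFormula L → (ℕ → A) → Prop
  | eq x y, β => β x = β y
  | rel R x, β => FirstOrder.Language.Structure.RelMap R (fun i => β (x i))
  | neg φ, β => ¬ φ.Realize β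
  | or φ ψ, β => φ.Realize β ∨ ψ.Realize β
  | ex y φ, β => ∃ a : A, φ.Realize (Function.update β y a)

/-- The set of free variables. -/
def free : FOFormula L → Set ℕ
  | eq x y => {x, y}
  | rel _ x => Set.range x
  | neg φ => φ.free
  | or φ ψ => φ.free ∪ ψ.free
  | ex y φ => φ.free \ {y}

/-- The size of a formula: its length as a word whose letters are the relation symbols, the
variables, the comma, the parentheses and the symbols `=`, `¬`, `∨`, `∃`. For `k ≥ 1` the atom
`R(x₁,…,xₖ)` has `1 + k + (k - 1) + 2` letters, the last two being the parentheses. -/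
def size : FOFormula L → ℕ
  | eq _ _ => 3
  | @rel _ k _ _ => 2 * k + 2
  | neg φ => φ.size + 1
  | or φ ψ => φ.size + ψ.size + 3
  | ex _ φ => φ.size + 2

mutual

/-- The least `n` such that the formula is in `Σ_n`: the number of alternating quantifier blocks,
counted from an existential outermost block; a negation exchanges the two kinds of blocks. -/
def sigmaDepth : FOFormula L → ℕ
  | eq _ _ => 0
  | rel _ _ => 0
  | neg φ => φ.piDepth
  | or φ ψ => max φ.sigmaDepth ψ.sigmaDepth
  | ex _ φ => max 1 φ.sigmaDepth

/-- The least `n` such that the formula is in `Π_n`: the number of alternating quantifier blocks,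
counted from a universal outermost block. An existential quantifier ends an (empty)
universal block. -/
def piDepth : FOFormula L → ℕ
  | eq _ _ => 0
  | rel _ _ => 0
  | neg φ => φ.sigmaDepth
  | or φ ψ => max φ.piDepth ψ.piDepth
  | ex _ φ => max 1 φ.sigmaDepth + 1

end

/-- The formula belongs to `Σ_n`: its quantifiers form at most `n` alternating blocks, the
outermost of which is existential. Formulas need not be in prenex form. `Σ_0` consists of the
quantifier-free formulas. -/
def IsSigma (n : ℕ) (φ : FOFormula L) : Prop := φ.sigmaDepth ≤ n

/-- `A ⊨ φ[a₁, …, aₖ]`, where the variable `x j` is interpreted as the element `a j`. -/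
def Satisfies {A : Type*} [L.Structure A] {k : ℕ} (φ : FOFormula L) (x : Fin k → ℕ)
    (a : Fin k → A) : Prop :=
  ∃ β : ℕ → A, (∀ j, β (x j) = a j) ∧ φ.Realize β

end FOFormula

section Spheres

variable (L : FirstOrder.Language.{u, v})

/-- The Gaifman graph of a structure: two distinct elements are adjacent iff they occur together
in a tuple of one of the relations. -/
def gaifmanGraph (A : Type*) [L.Structure A] : SimpleGraph A where
  Adj a b := a ≠ b ∧ ∃ (k : ℕ) (R : L.Relations k) (t : Fin k → A),
    FirstOrder.Language.Structure.RelMap R t ∧ a ∈ Set.range t ∧ b ∈ Set.range t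
  symm := ⟨fun _ _ ⟨h, k, R, t, hR, ha, hb⟩ => ⟨h.symm, k, R, t, hR, hb, ha⟩⟩
  loopless := ⟨fun _ h => h.1 rfl⟩

/-- The `r`-neighbourhood of a tuple: the elements at distance at most `r`, in the Gaifman graph,
from some entry of the tuple. -/
def neighbourhood {A : Type*} [L.Structure A] {k : ℕ} (r : ℕ) (a : Fin k → A) : Set A :=
  {b | ∃ i, (gaifmanGraph L A).edist (a i) b ≤ (r : ℕ∞)}

/-- The substructure induced on the `r`-neighbourhood of a tuple. Together with the tuple it is
the `r`-sphere of the tuple. -/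
def sphere [L.IsRelational] {A : Type*} [L.Structure A] {k : ℕ} (r : ℕ) (a : Fin k → A) :
    L.Substructure A where
  carrier := neighbourhood L r a
  fun_mem f := isEmptyElim f

theorem mem_sphere [L.IsRelational] {A : Type*} [L.Structure A] {k : ℕ} (r : ℕ)
    (a : Fin k → A) (i : Fin k) : a i ∈ sphere L r a :=
  ⟨i, by simp⟩

/-- The `r`-spheres of the two tuples are isomorphic, by an isomorphism that maps the entries of
the first tuple to the corresponding entries of the second. -/
def SphereIso [L.IsRelational] {A B : Type*} [L.Structure A] [L.Structure B] {k : ℕ} (r : ℕ)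
    (a : Fin k → A) (b : Fin k → B) : Prop :=
  ∃ e : sphere L r a ≃[L] sphere L r b, ∀ i, e ⟨a i, mem_sphere L r a i⟩ = ⟨b i, mem_sphere L r b i⟩

/-- `(A, a)` and `(B, b)` are `r`-equivalent: there is a bijection `f : A → B` such that the
`r`-spheres of `(a, c)` and `(b, f c)` are isomorphic for all `c` in `A`. -/
def REquivalent [L.IsRelational] {A B : Type*} [L.Structure A] [L.Structure B] {k : ℕ} (r : ℕ)
    (a : Fin k → A) (b : Fin k → B) : Prop :=
  ∃ f : A ≃ B, ∀ c : A,
    SphereIso L r (Fin.snoc a c : Fin (k + 1) → A) (Fin.snoc b (f c) : Fin (k + 1) → B)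

end Spheres

namespace FOFormula

variable {L : FirstOrder.Language.{u, v}} [L.IsRelational]

/-- `φ(x₁, …, xₖ)` does not distinguish `r`-equivalent finite structures with `k` distinguished
elements. (Every finite structure is isomorphic to one whose universe is in `Type`.) -/
def IsHanfLocalWith {k : ℕ} (φ : FOFormula L) (x : Fin k → ℕ) (r : ℕ) : Prop :=
  ∀ (A B : Type) [L.Structure A] [L.Structure B] [Finite A] [Finite B] [Nonempty A] [Nonempty B]
    (a : Fin k → A) (b : Fin k → B),
    REquivalent L r a b → (φ.Satisfies x a ↔ φ.Satisfies x b)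

/-- `φ(x₁, …, xₖ)` is Hanf-local. -/
def IsHanfLocal {k : ℕ} (φ : FOFormula L) (x : Fin k → ℕ) : Prop :=
  ∃ r, φ.IsHanfLocalWith x r

/-- The Hanf-locality rank of a Hanf-local formula `φ(x₁, …, xₖ)`: the least `r` for which it does
not distinguish `r`-equivalent structures. -/
noncomputable def hanfLocalityRank {k : ℕ} (φ : FOFormula L) (x : Fin k → ℕ) : ℕ :=
  sInf {r | φ.IsHanfLocalWith x r}

end FOFormula

end HanfLocality

-- A true $\Sigma_{n+1}$-formula of size $s$ owes its truth to the values of its outer existential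
-- quantifiers. These are $k$ elements $c$ with $4k\le s+1$, and truth passes to every $(B,b,d)$
-- that agrees with $(A,a,c)$ on the $\Sigma_n$-formulas of size at most $s$ (`witnessed`). Choosing
-- the entries of $d$ one by one would multiply the radius by a constant for each quantifier. They
-- are chosen at once instead (`Matches.extend`), at the cost of one factor linear in $k$: each
-- alternation multiplies radius plus one by $2s+1$.
--
-- The simultaneous choice rests on a count (`Matches.ncard_eq`): if the one-element extensions of
-- $a$ and $b$ are matched at a large radius, then $a$ and $b$ have equally many extensions by
-- $k$-tuples of each smaller sphere type. A tuple held together by links lies close to $a$ and one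
-- of its own entries, so a single sphere isomorphism transports it. Any other tuple splits into two
-- unlinked parts. Pairs of parts of the right types are counted by a product; the pairs that fail
-- to have the wanted joint type carry additional links, so they are counted by induction and
-- subtracted.
--
-- A tuple $d$ with the same $(3r+1)$-sphere as $c$ then gives a new bijection matching $r$-spheres
-- (`Sim.exists_matches`): near elements follow the isomorphism, far ones are paired by counting
-- types.

namespace HanfLocality

open FirstOrder.Language.Structure (RelMap)

-- Gaifman distance

section Geometry

variable (L : FirstOrder.Language.{u, v}) {A B C : Type} [L.Structure A] [L.Structure B]
  [L.Structure C] {ι κ : Type}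

/-- The Gaifman distance of two elements is at most `n`. -/
def Within (n : ℕ) (a b : A) : Prop := (gaifmanGraph L A).edist a b ≤ (n : ℕ∞)

/-- The neighbourhood of a family of elements. -/
def nbhd (r : ℕ) (x : ι → A) : Set A := {b | ∃ i, Within L r (x i) b}

/-- Two elements are equal or occur together in a tuple of elements of `S` of some relation. -/
def Touch (S : Set A) (a b : A) : Prop :=
  a = b ∨ ∃ (k : ℕ) (R : L.Relations k) (t : Fin k → A),
    RelMap R t ∧ (∀ i, t i ∈ S) ∧ a ∈ Set.range t ∧ b ∈ Set.range t

variable {L}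

theorem within_refl (n : ℕ) (a : A) : Within L n a a := by simp [Within]

theorem Within.symm {n : ℕ} {a b : A} (h : Within L n a b) : Within L n b a := by
  unfold Within at *; rwa [SimpleGraph.edist_comm]

theorem Within.trans {m n : ℕ} {a b c : A} (h : Within L m a b) (h' : Within L n b c) :
    Within L (m + n) a c := by
  unfold Within at *
  push_cast
  exact SimpleGraph.edist_triangle.trans (add_le_add h h')

theorem Within.mono {m n : ℕ} {a b : A} (h : Within L m a b) (hmn : m ≤ n) : Within L n a b :=
  le_trans h (by exact_mod_cast hmn)

theorem within_zero {a b : A} : Within L 0 a b ↔ a = b := by simp [Within]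

theorem within_one_of_rel {k : ℕ} {R : L.Relations k} {t : Fin k → A} (h : RelMap R t)
    (i j : Fin k) : Within L 1 (t i) (t j) := by
  by_cases hij : t i = t j
  · rw [hij]; exact within_refl _ _
  · have : (gaifmanGraph L A).Adj (t i) (t j) := ⟨hij, k, R, t, h, ⟨i, rfl⟩, ⟨j, rfl⟩⟩
    simpa [Within] using (SimpleGraph.edist_eq_one_iff_adj.2 this).le

theorem Touch.within {S : Set A} {a b : A} (h : Touch L S a b) : Within L 1 a b := by
  rcases h with rfl | ⟨k, R, t, ht, -, ⟨i, rfl⟩, ⟨j, rfl⟩⟩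
  · exact within_refl _ _
  · exact within_one_of_rel ht i j

theorem Touch.symm {S : Set A} {a b : A} (h : Touch L S a b) : Touch L S b a := by
  rcases h with rfl | ⟨k, R, t, ht, hS, ha, hb⟩
  · exact Or.inl rfl
  · exact Or.inr ⟨k, R, t, ht, hS, hb, ha⟩

theorem Within.exists_last {n : ℕ} {a b : A} (h : Within L (n + 1) a b) :
    ∃ c, Within L n a c ∧ Touch L Set.univ c b := by
  have h' : Within L (n + 1) b a := h.symm
  unfold Within at h'
  obtain ⟨p, hp⟩ := SimpleGraph.exists_walk_of_edist_ne_top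
    (ne_top_of_le_ne_top (ENat.natCast_ne_top _) h')
  rw [← hp] at h'
  have hl : p.length ≤ n + 1 := by exact_mod_cast h'
  cases p with
  | nil => exact ⟨_, within_refl _ _, Or.inl rfl⟩
  | @cons _ c _ hadj q =>
    refine ⟨c, Within.symm ?_, ?_⟩
    · simp only [SimpleGraph.Walk.length_cons] at hl
      exact (SimpleGraph.Walk.edist_le q).trans (by exact_mod_cast (by omega))
    · obtain ⟨-, k, R, t, ht, hb, hc⟩ := hadj
      exact Or.inr ⟨k, R, t, ht, fun _ => trivial, hc, hb⟩

theorem mem_nbhd_self (r : ℕ) (x : ι → A) (i : ι) : x i ∈ nbhd L r x := ⟨i, within_refl _ _⟩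

-- Sphere isomorphisms as partial bijections

/-- A partial bijection that preserves and reflects the relations on its source. -/
def PreservesRel (L : FirstOrder.Language.{u, v}) [L.Structure A] [L.Structure B]
    (e : PartialEquiv A B) : Prop :=
  ∀ (k : ℕ) (R : L.Relations k) (t : Fin k → A), (∀ i, t i ∈ e.source) →
    (RelMap R (e ∘ t) ↔ RelMap R t)

theorem PreservesRel.symm {e : PartialEquiv A B} (h : PreservesRel L e) :
    PreservesRel L e.symm := by
  intro k R t ht
  rw [← h k R (e.symm ∘ t) fun i => e.map_target (ht i)]
  have : e ∘ e.symm ∘ t = t := funext fun i => e.right_inv (ht i)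
  rw [this]

theorem PreservesRel.touch {e : PartialEquiv A B} (h : PreservesRel L e) {S : Set A} {T : Set B}
    {a b : A} (hS : S ⊆ e.source) (hST : ∀ c ∈ S, e c ∈ T) (hab : Touch L S a b) :
    Touch L T (e a) (e b) := by
  rcases hab with rfl | ⟨k, R, t, ht, hm, ⟨i, rfl⟩, ⟨j, rfl⟩⟩
  · exact Or.inl rfl
  · exact Or.inr ⟨k, R, e ∘ t, (h k R t fun i => hS (hm i)).2 ht, fun i => hST _ (hm i),
      ⟨i, rfl⟩, ⟨j, rfl⟩⟩

theorem PreservesRel.within {e : PartialEquiv A B} (h : PreservesRel L e) {r : ℕ} {a : A}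
    (ha : ∀ b, Within L r a b → b ∈ e.source) {n : ℕ} (hn : n ≤ r) {b : A}
    (hb : Within L n a b) : Within L n (e a) (e b) := by
  induction n generalizing b with
  | zero => rw [within_zero] at *; rw [hb]
  | succ n ih =>
    obtain ⟨c, hc, hcb⟩ := hb.exists_last
    refine (ih (by omega) hc).trans ?_
    rcases hcb with rfl | ⟨k, R, t, ht, -, ⟨i, rfl⟩, ⟨j, rfl⟩⟩
    · exact within_refl _ _
    -- The tuple contains `c`, so all its entries stay within `n + 1 ≤ r` of `a`, hence in the
    -- source.
    · have : RelMap R (e ∘ t) := (h k R t fun l =>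
        ha _ ((hc.trans (within_one_of_rel ht i l)).mono hn)).2 ht
      exact within_one_of_rel this i j

/-- `e` is an isomorphism between the `r`-spheres of two families. -/
structure IsSphereIso (L : FirstOrder.Language.{u, v}) [L.Structure A] [L.Structure B] (r : ℕ)
    (x : ι → A) (y : ι → B) (e : PartialEquiv A B) : Prop where
  source_eq : e.source = nbhd L r x
  target_eq : e.target = nbhd L r y
  preservesRel : PreservesRel L e
  map_center : ∀ i, e (x i) = y i

/-- The `r`-spheres of two families are isomorphic. -/
def Sim (L : FirstOrder.Language.{u, v}) [L.Structure A] [L.Structure B] (r : ℕ)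
    (x : ι → A) (y : ι → B) : Prop := ∃ e, IsSphereIso L r x y e

theorem IsSphereIso.symm {r : ℕ} {x : ι → A} {y : ι → B} {e : PartialEquiv A B}
    (h : IsSphereIso L r x y e) : IsSphereIso L r y x e.symm where
  source_eq := h.target_eq
  target_eq := h.source_eq
  preservesRel := h.preservesRel.symm
  map_center i := by
    rw [← h.map_center i]
    exact e.left_inv (h.source_eq ▸ mem_nbhd_self r x i)

theorem Sim.symm {r : ℕ} {x : ι → A} {y : ι → B} (h : Sim L r x y) : Sim L r y x :=
  let ⟨e, he⟩ := h; ⟨e.symm, he.symm⟩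

theorem Sim.refl (r : ℕ) (x : ι → A) : Sim L r x x :=
  ⟨PartialEquiv.ofSet (nbhd L r x), rfl, rfl, fun _ _ _ _ => Iff.rfl, fun _ => rfl⟩

theorem Sim.trans {r : ℕ} {x : ι → A} {y : ι → B} {z : ι → C} (h : Sim L r x y)
    (h' : Sim L r y z) : Sim L r x z := by
  obtain ⟨e, he⟩ := h
  obtain ⟨e', he'⟩ := h'
  have hm : e.target = e'.source := he.target_eq.trans he'.source_eq.symm
  refine ⟨e.trans' e' hm, he.source_eq, he'.target_eq, ?_, ?_⟩
  · intro k R t ht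
    have h2 : RelMap R (e' ∘ e ∘ t) ↔ RelMap R (e ∘ t) :=
      he'.preservesRel k R (e ∘ t) fun i => hm ▸ e.map_source (ht i)
    exact h2.trans (he.preservesRel k R t ht)
  · intro i
    change e' (e (x i)) = z i
    rw [he.map_center, he'.map_center]

theorem IsSphereIso.within {r : ℕ} {x : ι → A} {y : ι → B} {e : PartialEquiv A B}
    (h : IsSphereIso L r x y e) {n : ℕ} (hn : n ≤ r) {i : ι} {b : A}
    (hb : Within L n (x i) b) : Within L n (y i) (e b) := by
  rw [← h.map_center i]
  exact h.preservesRel.within (fun c hc => by rw [h.source_eq]; exact ⟨i, hc⟩) hn hb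

/-- A sphere isomorphism restricts to the spheres of families of elements that lie deep enough in
the sphere. -/
theorem IsSphereIso.restrict {r s : ℕ} {x : ι → A} {y : ι → B} {e : PartialEquiv A B}
    (h : IsSphereIso L r x y e) {w : κ → A} {n : ℕ} (hn : n + s ≤ r)
    (hw : ∀ j, ∃ i, Within L n (x i) (w j)) :
    ∃ e' : PartialEquiv A B, IsSphereIso L s w (e ∘ w) e' ∧ ∀ a, e' a = e a := by
  have hsub : nbhd L s w ⊆ e.source := by
    rintro b ⟨j, hj⟩
    obtain ⟨i, hi⟩ := hw j
    rw [h.source_eq]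
    exact ⟨i, (hi.trans hj).mono hn⟩
  have hsub' : nbhd L s (e ∘ w) ⊆ e.target := by
    rintro b ⟨j, hj⟩
    obtain ⟨i, hi⟩ := hw j
    rw [h.target_eq]
    exact ⟨i, ((h.within (by omega) hi).trans hj).mono hn⟩
  have hws : ∀ j, w j ∈ e.source := fun j => hsub (mem_nbhd_self s w j)
  -- Both `e` and its inverse preserve short distances around the `w j`, so the two balls correspond
  -- exactly.
  have himg : e.IsImage (nbhd L s w) (nbhd L s (e ∘ w)) := by
    intro b hb
    constructor
    · rintro ⟨j, hj⟩
      refine ⟨j, ?_⟩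
      have := h.preservesRel.symm.within (a := e (w j)) (r := s)
        (fun c hc => hsub' ⟨j, hc⟩) le_rfl hj
      rwa [e.left_inv hb, e.left_inv (hws j)] at this
    · rintro ⟨j, hj⟩
      exact ⟨j, h.preservesRel.within (fun c hc => hsub ⟨j, hc⟩) le_rfl hj⟩
  refine ⟨himg.restr, ⟨?_, ?_, ?_, fun _ => rfl⟩, fun _ => rfl⟩
  · exact Set.inter_eq_right.2 hsub
  · exact Set.inter_eq_right.2 hsub'
  · intro k R t ht
    exact h.preservesRel k R t fun i => (ht i).1

theorem Sim.comp {r s : ℕ} {x : ι → A} {y : ι → B} (h : Sim L r x y) (hs : s ≤ r)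
    (f : κ → ι) : Sim L s (x ∘ f) (y ∘ f) := by
  obtain ⟨e, he⟩ := h
  obtain ⟨e', he', -⟩ := he.restrict (w := x ∘ f) (s := s) (n := 0) (by omega)
    fun j => ⟨f j, within_refl _ _⟩
  have : e ∘ x ∘ f = y ∘ f := funext fun j => he.map_center (f j)
  exact ⟨e', this ▸ he'⟩

-- Links between spheres, and gluing of unlinked parts

/-- The spheres of two entries of a family overlap, or are connected by a tuple of a relation
inside of the sphere of the family. -/
def Link (L : FirstOrder.Language.{u, v}) [L.Structure A] (r : ℕ) (x : ι → A) (i j : ι) : Prop :=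
  ∃ a b, Within L r (x i) a ∧ Within L r (x j) b ∧ Touch L (nbhd L r x) a b

theorem Link.within {r : ℕ} {x : ι → A} {i j : ι} (h : Link L r x i j) :
    Within L (2 * r + 1) (x i) (x j) := by
  obtain ⟨a, b, ha, hb, hab⟩ := h
  exact ((ha.trans hab.within).trans hb.symm).mono (by omega)

theorem Link.symm {r : ℕ} {x : ι → A} {i j : ι} (h : Link L r x i j) : Link L r x j i := by
  obtain ⟨a, b, ha, hb, hab⟩ := h
  exact ⟨b, a, hb, ha, hab.symm⟩

theorem Link.of_comp {r : ℕ} {x : ι → A} {f : κ → ι} {i j : κ} (h : Link L r (x ∘ f) i j) :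
    Link L r x (f i) (f j) := by
  obtain ⟨a, b, ha, hb, hab⟩ := h
  refine ⟨a, b, ha, hb, ?_⟩
  rcases hab with rfl | ⟨k, R, t, ht, hm, h1, h2⟩
  · exact Or.inl rfl
  · exact Or.inr ⟨k, R, t, ht, fun l => (hm l).imp' f fun _ => id, h1, h2⟩

/-- A link is visible inside the sphere, because the connecting tuple is required to lie in the
neighbourhood of the family; a sphere isomorphism therefore carries it along. -/
theorem Sim.link {r : ℕ} {x : ι → A} {y : ι → B} (h : Sim L r x y) {i j : ι}
    (hl : Link L r x i j) : Link L r y i j := by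
  obtain ⟨e, he⟩ := h
  obtain ⟨a, b, ha, hb, hab⟩ := hl
  exact ⟨e a, e b, he.within le_rfl ha, he.within le_rfl hb, he.preservesRel.touch
    he.source_eq.ge (fun c ⟨l, hc⟩ => ⟨l, he.within le_rfl hc⟩) hab⟩

/-- The indices in the range of `f` are not linked to those in the range of `g`. -/
def Separated (L : FirstOrder.Language.{u, v}) [L.Structure A] (r : ℕ) (x : ι → A) {κ' : Type}
    (f : κ → ι) (g : κ' → ι) : Prop := ∀ i j, ¬ Link L r x (f i) (g j)

variable {κ' : Type}

theorem Separated.disjoint {r : ℕ} {x : ι → A} {f : κ → ι} {g : κ' → ι}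
    (h : Separated L r x f g) : Disjoint (nbhd L r (x ∘ f)) (nbhd L r (x ∘ g)) := by
  rw [Set.disjoint_left]
  rintro a ⟨i, hi⟩ ⟨j, hj⟩
  exact h i j ⟨a, a, hi, hj, Or.inl rfl⟩

theorem nbhd_eq_union {r : ℕ} (x : ι → A) {f : κ → ι} {g : κ' → ι}
    (hfg : ∀ i, i ∈ Set.range f ∨ i ∈ Set.range g) :
    nbhd L r x = nbhd L r (x ∘ f) ∪ nbhd L r (x ∘ g) := by
  ext b
  constructor
  · rintro ⟨i, hi⟩
    rcases hfg i with ⟨j, rfl⟩ | ⟨j, rfl⟩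
    · exact Or.inl ⟨j, hi⟩
    · exact Or.inr ⟨j, hi⟩
  · rintro (⟨j, hj⟩ | ⟨j, hj⟩)
    · exact ⟨_, hj⟩
    · exact ⟨_, hj⟩

theorem Separated.tuple {r : ℕ} {x : ι → A} {f : κ → ι} {g : κ' → ι}
    (h : Separated L r x f g) (hfg : ∀ i, i ∈ Set.range f ∨ i ∈ Set.range g) {k : ℕ}
    {R : L.Relations k} {t : Fin k → A} (ht : RelMap R t) (hm : ∀ l, t l ∈ nbhd L r x) :
    (∀ l, t l ∈ nbhd L r (x ∘ f)) ∨ ∀ l, t l ∈ nbhd L r (x ∘ g) := by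
  by_contra! hcon
  obtain ⟨⟨l, hl⟩, l', hl'⟩ := hcon
  have hu := nbhd_eq_union (L := L) (r := r) x hfg
  have h1 := hm l
  have h2 := hm l'
  rw [hu] at h1 h2
  obtain ⟨j, hj⟩ := h1.resolve_left hl
  obtain ⟨i, hi⟩ := h2.resolve_right hl'
  exact h i j ⟨_, _, hi, hj, Or.inr ⟨k, R, t, ht, hm, ⟨l', rfl⟩, ⟨l, rfl⟩⟩⟩

open Classical in
/-- Isomorphisms of the spheres of two separated parts combine. -/
theorem Sim.union {r : ℕ} {x : ι → A} {y : ι → B} {f : κ → ι} {g : κ' → ι}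
    (hfg : ∀ i, i ∈ Set.range f ∨ i ∈ Set.range g)
    (hx : Separated L r x f g) (hy : Separated L r y f g)
    (h1 : Sim L r (x ∘ f) (y ∘ f)) (h2 : Sim L r (x ∘ g) (y ∘ g)) : Sim L r x y := by
  obtain ⟨e₁, he₁⟩ := h1
  obtain ⟨e₂, he₂⟩ := h2
  have hs : Disjoint e₁.source e₂.source := by
    rw [he₁.source_eq, he₂.source_eq]; exact hx.disjoint
  have ht : Disjoint e₁.target e₂.target := by
    rw [he₁.target_eq, he₂.target_eq]; exact hy.disjoint
  set e := e₁.disjointUnion e₂ hs ht with he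
  have hE1 : ∀ a ∈ e₁.source, e a = e₁ a := fun a ha => by
    rw [he, PartialEquiv.disjointUnion_eq_piecewise]
    exact Set.piecewise_eq_of_mem _ _ _ ha
  have hE2 : ∀ a ∈ e₂.source, e a = e₂ a := fun a ha => by
    have : a ∉ e₁.source := fun h => Set.disjoint_left.1 hs h ha
    rw [he, PartialEquiv.disjointUnion_eq_piecewise]
    exact Set.piecewise_eq_of_notMem _ _ _ this
  have hsrc : e.source = nbhd L r x := by
    rw [nbhd_eq_union x hfg, ← he₁.source_eq, ← he₂.source_eq]; rfl
  have htgt : e.target = nbhd L r y := by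
    rw [nbhd_eq_union y hfg, ← he₁.target_eq, ← he₂.target_eq]; rfl
  refine ⟨e, hsrc, htgt, ?_, ?_⟩
  · intro k R t hm
    have c1 : (∀ i, t i ∈ e₁.source) → (RelMap R (e ∘ t) ↔ RelMap R t) := by
      intro h
      have : e ∘ t = e₁ ∘ t := funext fun i => hE1 _ (h i)
      rw [this]; exact he₁.preservesRel k R t h
    have c2 : (∀ i, t i ∈ e₂.source) → (RelMap R (e ∘ t) ↔ RelMap R t) := by
      intro h
      have : e ∘ t = e₂ ∘ t := funext fun i => hE2 _ (h i)
      rw [this]; exact he₂.preservesRel k R t h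
    have hor : ∀ i, t i ∈ e₁.source ∨ t i ∈ e₂.source := hm
    constructor
    · intro h
      -- The image tuple lies in one of the two disjoint targets, which forces `t` into the
      -- corresponding source.
      rcases hy.tuple hfg h fun i => htgt ▸ e.map_source (hm i) with h' | h'
      · refine (c1 fun i => (hor i).resolve_right fun h2 => ?_).1 h
        have := h' i
        rw [← he₁.target_eq] at this
        refine Set.disjoint_left.1 ht this ?_
        change e (t i) ∈ _
        rw [hE2 _ h2]
        exact e₂.map_source h2
      · refine (c2 fun i => (hor i).resolve_left fun h1 => ?_).1 h
        have := h' i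
        rw [← he₂.target_eq] at this
        refine Set.disjoint_left.1 ht ?_ this
        change e (t i) ∈ _
        rw [hE1 _ h1]
        exact e₁.map_source h1
    · intro h
      rcases hx.tuple hfg h fun i => hsrc ▸ hm i with h' | h'
      · exact (c1 fun i => he₁.source_eq ▸ h' i).2 h
      · exact (c2 fun i => he₂.source_eq ▸ h' i).2 h
  · intro i
    rcases hfg i with ⟨j, rfl⟩ | ⟨j, rfl⟩
    · rw [hE1 _ (by rw [he₁.source_eq]; exact mem_nbhd_self r (x ∘ f) j)]
      exact he₁.map_center j
    · rw [hE2 _ (by rw [he₂.source_eq]; exact mem_nbhd_self r (x ∘ g) j)]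
      exact he₂.map_center j

/-- The links of a separated family persist in every family whose two parts have the same
spheres. -/
theorem Separated.link_mono {r : ℕ} {x : ι → A} {y : ι → B} {f : κ → ι} {g : κ' → ι}
    (hfg : ∀ i, i ∈ Set.range f ∨ i ∈ Set.range g) (hx : Separated L r x f g)
    (h1 : Sim L r (x ∘ f) (y ∘ f)) (h2 : Sim L r (x ∘ g) (y ∘ g)) {i j : ι}
    (h : Link L r x i j) : Link L r y i j := by
  have hd := hx.disjoint
  -- In a separated family a link joins two indices of the same part, and its tuple lies in the
  -- neighbourhood of that part.
  have key : ∀ {i' j'}, Link L r x i' j' →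
      (∃ k k', f k = i' ∧ f k' = j' ∧ Link L r (x ∘ f) k k') ∨
        ∃ k k', g k = i' ∧ g k' = j' ∧ Link L r (x ∘ g) k k' := by
    intro i j hij
    rcases hfg i with ⟨k, rfl⟩ | ⟨k, rfl⟩ <;> rcases hfg j with ⟨k', rfl⟩ | ⟨k', rfl⟩
    · refine Or.inl ⟨k, k', rfl, rfl, ?_⟩
      obtain ⟨a, b, ha, hb, hab⟩ := hij
      refine ⟨a, b, ha, hb, ?_⟩
      rcases hab with rfl | ⟨n, R, t, ht, hm, ⟨l, rfl⟩, hl'⟩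
      · exact Or.inl rfl
      rcases hx.tuple hfg ht hm with h' | h'
      · exact Or.inr ⟨n, R, t, ht, h', ⟨l, rfl⟩, hl'⟩
      · exact absurd (h' l) (Set.disjoint_left.1 hd ⟨k, ha⟩)
    · exact absurd hij (hx k k')
    · exact absurd hij.symm (hx k' k)
    · refine Or.inr ⟨k, k', rfl, rfl, ?_⟩
      obtain ⟨a, b, ha, hb, hab⟩ := hij
      refine ⟨a, b, ha, hb, ?_⟩
      rcases hab with rfl | ⟨n, R, t, ht, hm, ⟨l, rfl⟩, hl'⟩
      · exact Or.inl rfl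
      rcases hx.tuple hfg ht hm with h' | h'
      · exact absurd ⟨k, ha⟩ (Set.disjoint_left.1 hd (h' l))
      · exact Or.inr ⟨n, R, t, ht, h', ⟨l, rfl⟩, hl'⟩
  rcases key h with ⟨k, k', rfl, rfl, hk⟩ | ⟨k, k', rfl, rfl, hk⟩
  · exact (h1.link hk).of_comp
  · exact (h2.link hk).of_comp

end Geometry

-- Counting tuples by sphere type

section Counting

theorem exists_equiv_of_card_fiber_eq {α β : Type} {T : Type*} [Finite α] [Finite β] (t : α → T)
    (t' : β → T) (h : ∀ τ, Nat.card {a // t a = τ} = Nat.card {b // t' b = τ}) :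
    ∃ e : α ≃ β, ∀ a, t' (e a) = t a := by
  have hne : ∀ τ, Nonempty ({a // t a = τ} ≃ {b // t' b = τ}) := fun τ =>
    (Finite.card_eq).1 (h τ)
  choose e he using fun τ => (hne τ).elim fun e => (⟨e, trivial⟩ :
    ∃ _ : {a // t a = τ} ≃ {b // t' b = τ}, True)
  refine ⟨(Equiv.sigmaFiberEquiv t).symm.trans
    ((Equiv.sigmaCongrRight e).trans (Equiv.sigmaFiberEquiv t')), fun a => ?_⟩
  exact (e (t a) ⟨a, rfl⟩).2

/-- Equal frequencies are needed only for the types in `W`; the count of `Matches.ncard_eq` knows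
them only for types with more links. -/
theorem ncard_preimage_eq {α β : Type} {T : Type*} [Finite α] [Finite β] (t : α → T)
    (t' : β → T) (W : Set T) (h : ∀ τ ∈ W, {a | t a = τ}.ncard = {b | t' b = τ}.ncard) :
    {a | t a ∈ W}.ncard = {b | t' b ∈ W}.ncard := by
  obtain ⟨e, -⟩ := exists_equiv_of_card_fiber_eq (fun a : {a | t a ∈ W} => t a)
    (fun b : {b | t' b ∈ W} => t' b) fun τ => by
      by_cases hτ : τ ∈ W
      · have h1 : Nat.card {a : {a | t a ∈ W} // t a = τ} = {a | t a = τ}.ncard :=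
          Nat.card_congr (Equiv.subtypeSubtypeEquivSubtype (p := fun a => t a ∈ W)
            (q := fun a => t a = τ) fun {a} ha => by rw [ha]; exact hτ)
        have h2 : Nat.card {b : {b | t' b ∈ W} // t' b = τ} = {b | t' b = τ}.ncard :=
          Nat.card_congr (Equiv.subtypeSubtypeEquivSubtype (p := fun b => t' b ∈ W)
            (q := fun b => t' b = τ) fun {b} hb => by rw [hb]; exact hτ)
        rw [h1, h2, h τ hτ]
      · have h1 : IsEmpty {a : {a | t a ∈ W} // t a = τ} := ⟨fun a => hτ (a.2 ▸ a.1.2)⟩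
        have h2 : IsEmpty {b : {b | t' b ∈ W} // t' b = τ} := ⟨fun b => hτ (b.2 ▸ b.1.2)⟩
        simp
  exact Nat.card_congr e

theorem ncard_fiber_eq_of_equiv {α β : Type} {T : Type*} {t : α → T} {t' : β → T} (e : α ≃ β)
    (h : ∀ a, t' (e a) = t a) (τ : T) : {a | t a = τ}.ncard = {b | t' b = τ}.ncard :=
  Nat.card_congr (e.subtypeEquiv fun a => by simp [h])

variable (L : FirstOrder.Language.{u, v}) {A B : Type} [L.Structure A] [L.Structure B]
  {ι I : Type}

/-- The isomorphism type of the sphere of a family. -/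
def sphereType (r : ℕ) (x : ι → A) (X : Type) (_ : L.Structure X) (y : ι → X) : Prop :=
  Sim L r x y

variable {L}

/-- A type is the predicate of being similar to the family, over all structures, so that families in
`A` and in `B` have types in one place. Evaluating the predicate at `y` recovers the isomorphism. -/
theorem sphereType_eq_iff {r : ℕ} {x : ι → A} {y : ι → B} :
    sphereType L r x = sphereType L r y ↔ Sim L r x y := by
  constructor
  · intro h
    have := congrFun (congrFun (congrFun h B) inferInstance) y
    exact this.mpr (Sim.refl r y)
  · intro h
    funext X _ z
    exact propext ⟨fun h' => h.symm.trans h', fun h' => h.trans h'⟩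

/-- The family is not the union of two unlinked parts one of which contains `i₀` and the entries
indexed by `ι`. -/
def LinkConnected (L : FirstOrder.Language.{u, v}) [L.Structure A] (r : ℕ) (w : ι ⊕ I → A)
    (i₀ : I) : Prop :=
  ∀ P : I → Prop, P i₀ → (∃ i, ¬ P i) →
    ∃ i, ¬ P i ∧ ∃ j : ι ⊕ I, (∀ i', j = Sum.inr i' → P i') ∧ Link L r w j (Sum.inr i)

theorem LinkConnected.of_sim {r : ℕ} {w : ι ⊕ I → A} {w' : ι ⊕ I → B} {i₀ : I}
    (h : LinkConnected L r w i₀) (hs : Sim L r w w') : LinkConnected L r w' i₀ := by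
  intro P h0 h1
  obtain ⟨i, hi, j, hj, hl⟩ := h P h0 h1
  exact ⟨i, hi, j, hj, hs.link hl⟩

/-- The set of indices reached within `n * (2 * r + 1)` gains an element whenever `n` grows by one,
until it is everything; one index is reached at the start, so `Nat.card I - 1` rounds suffice. -/
theorem LinkConnected.within [Finite I] {r : ℕ} {z : ι → A} {x : I → A} {i₀ : I}
    (h : LinkConnected L r (Sum.elim z x) i₀) (i : I) :
    ∃ j : ι ⊕ Unit, Within L ((Nat.card I - 1) * (2 * r + 1))
      (Sum.elim z (fun _ : Unit => x i₀) j) (x i) := by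
  let P : ℕ → I → Prop := fun n i => ∃ j : ι ⊕ Unit,
    Within L (n * (2 * r + 1)) (Sum.elim z (fun _ : Unit => x i₀) j) (x i)
  have hP0 : ∀ n, P n i₀ := fun n => ⟨Sum.inr (), within_refl _ _⟩
  have key : ∀ n, n < Nat.card I → n + 1 ≤ {i | P n i}.ncard := by
    intro n
    induction n with
    | zero => exact fun _ => (Set.ncard_pos).2 ⟨i₀, hP0 0⟩
    | succ n ih =>
      intro hn
      have ih := ih (by omega)
      have hsub : {i | P n i} ⊆ {i | P (n + 1) i} := by
        rintro i ⟨j, hj⟩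
        exact ⟨j, hj.mono (Nat.mul_le_mul_right _ (by omega))⟩
      by_cases hall : ∃ i, ¬ P n i
      · obtain ⟨i, hi, j, hj, hl⟩ := h (P n) (hP0 n) hall
        have hlt : {i | P n i} ⊂ {i | P (n + 1) i} := by
          refine (Set.ssubset_iff_of_subset hsub).2 ⟨i, ?_, hi⟩
          have hw := hl.within
          rcases j with j | j
          · refine ⟨Sum.inl j, hw.mono ?_⟩
            rw [Nat.add_mul]; omega
          · obtain ⟨j', hj'⟩ := hj j rfl
            refine ⟨j', (hj'.trans hw).mono ?_⟩
            rw [Nat.add_mul, Nat.one_mul]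
        have := Set.ncard_lt_ncard hlt
        omega
      · push Not at hall
        have : {i | P (n + 1) i} = Set.univ :=
          Set.eq_univ_of_forall fun i => hsub (hall i)
        rw [this, Set.ncard_univ]
        exact hn
  have hpos : 0 < Nat.card I := Nat.card_pos_iff.2 ⟨⟨i₀⟩, inferInstance⟩
  have h1 := key (Nat.card I - 1) (by omega)
  have h2 : {i | P (Nat.card I - 1) i} = Set.univ := by
    refine Set.eq_of_subset_of_ncard_le (Set.subset_univ _) ?_
    rw [Set.ncard_univ]
    omega
  have : i ∈ {i | P (Nat.card I - 1) i} := by rw [h2]; trivial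
  exact this

/-- `f` matches the `r`-spheres of the two families, each extended by one more element. -/
def Matches (L : FirstOrder.Language.{u, v}) [L.Structure A] [L.Structure B] (r : ℕ)
    (a : ι → A) (b : ι → B) (f : A ≃ B) : Prop :=
  ∀ c, Sim L r (Sum.elim a fun _ : Unit => c) (Sum.elim b fun _ : Unit => f c)

theorem Matches.symm {r : ℕ} {a : ι → A} {b : ι → B} {f : A ≃ B} (h : Matches L r a b f) :
    Matches L r b a f.symm := fun c => by
  have := (h (f.symm c)).symm
  rwa [f.apply_symm_apply] at this

/-- Every connected tuple lies, with its `r`-sphere, in the `R`-sphere of `a` and `c i₀`, so the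
isomorphism chosen for `c i₀` transports it. -/
theorem Matches.ncard_le [Finite A] [Finite B] [Finite I] {R r : ℕ} {a : ι → A} {b : ι → B}
    {f : A ≃ B} (h : Matches L R a b f) {X : Type} [L.Structure X] {z : ι → X} {x : I → X} {i₀ : I}
    (hR : (Nat.card I - 1) * (2 * r + 1) + r ≤ R) (hx : LinkConnected L r (Sum.elim z x) i₀) :
    {c : I → A | Sim L r (Sum.elim a c) (Sum.elim z x)}.ncard ≤
      {d : I → B | Sim L r (Sum.elim b d) (Sum.elim z x)}.ncard := by
  choose e he using h
  have hin : ∀ c : I → A, Sim L r (Sum.elim a c) (Sum.elim z x) → ∀ i, ∃ j : ι ⊕ Unit,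
      Within L ((Nat.card I - 1) * (2 * r + 1)) (Sum.elim a (fun _ : Unit => c i₀) j) (c i) :=
    fun c hc i => (hx.of_sim hc.symm).within i
  refine Set.ncard_le_ncard_of_injOn (fun c i => e (c i₀) (c i)) ?_ ?_
  · intro c hc
    obtain ⟨e', he', -⟩ := (he (c i₀)).restrict (w := Sum.elim a c) hR (by
      rintro (j | i)
      · exact ⟨Sum.inl j, within_refl _ _⟩
      · exact hin c hc i)
    have : e (c i₀) ∘ Sum.elim a c = Sum.elim b fun i => e (c i₀) (c i) := by
      funext j
      rcases j with j | j
      · exact (he (c i₀)).map_center (Sum.inl j)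
      · rfl
    rw [this] at he'
    exact Sim.trans (Sim.symm ⟨e', he'⟩) hc
  · intro c hc c' hc' hcc
    -- The entry at `i₀` is sent to its image under `f`, so the image tuple determines `c i₀` and
    -- thus the isomorphism that was used.
    have h0 : c i₀ = c' i₀ := by
      have h1 := congrFun hcc i₀
      have h2 := (he (c i₀)).map_center (Sum.inr ())
      have h3 := (he (c' i₀)).map_center (Sum.inr ())
      simp only [Sum.elim_inr] at h1 h2 h3
      rw [h2, h3] at h1
      exact f.injective h1
    funext i
    have h1 := congrFun hcc i
    simp only at h1
    have hs : ∀ c : I → A, Sim L r (Sum.elim a c) (Sum.elim z x) → c i ∈ (e (c i₀)).source := by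
      intro c hc
      rw [(he (c i₀)).source_eq]
      obtain ⟨j, hj⟩ := hin c hc i
      exact ⟨j, hj.mono (by omega)⟩
    have m1 := hs c hc
    have m2 := hs c' hc'
    rw [← h0] at h1 m2
    exact (e (c i₀)).injOn m1 m2 h1

/-- Families of elements whose restrictions to `P` and to its complement have given spheres. -/
theorem ncard_parts (P : I → Prop) [Finite I] [Finite A] (S : ({i // P i} → A) → Prop)
    (T : ({i // ¬ P i} → A) → Prop) :
    {c : I → A | S (fun i => c i) ∧ T (fun i => c i)}.ncard =
      {c | S c}.ncard * {c | T c}.ncard := by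
  classical
  rw [← Set.ncard_prod]
  exact Nat.card_congr ((Equiv.piEquivPiSubtypeProd P fun _ => A).subtypeEquiv fun c => Iff.rfl)

/-- Matched structures have the same number of families with a given sphere type. -/
theorem Matches.ncard_eq [Finite A] [Finite B] [Finite ι] {R r : ℕ} {a : ι → A} {b : ι → B}
    {f : A ≃ B} (h : Matches L R a b f) (n : ℕ) (hn : (n - 1) * (2 * r + 1) + r ≤ R)
    (I : Type) [Finite I] [Nonempty I] (hI : Nat.card I ≤ n)
    {X : Type} [L.Structure X] (z : ι → X) (x : I → X) :
    {c : I → A | Sim L r (Sum.elim a c) (Sum.elim z x)}.ncard =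
      {d : I → B | Sim L r (Sum.elim b d) (Sum.elim z x)}.ncard := by
  induction n generalizing I X with
  | zero => exact absurd hI (by have := Nat.card_pos (α := I); omega)
  | succ n ihn =>
  have hIR : (Nat.card I - 1) * (2 * r + 1) + r ≤ R :=
    le_trans (Nat.add_le_add_right (Nat.mul_le_mul_right _ (by omega)) _) hn
  have hnR : (n - 1) * (2 * r + 1) + r ≤ R :=
    le_trans (Nat.add_le_add_right (Nat.mul_le_mul_right _ (by omega)) _) hn
  -- Inner induction on the number of unlinked pairs of the reference family, which may live in any
  -- structure.
  induction hm : {p : (ι ⊕ I) × (ι ⊕ I) | ¬ Link L r (Sum.elim z x) p.1 p.2}.ncard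
    using Nat.strong_induction_on generalizing X with
  | _ m ihm =>
  subst hm
  obtain ⟨i₀⟩ := ‹Nonempty I›
  by_cases hx : LinkConnected L r (Sum.elim z x) i₀
  · exact le_antisymm (h.ncard_le hIR hx) (h.symm.ncard_le hIR hx)
  unfold LinkConnected at hx
  push Not at hx
  obtain ⟨P, hP0, ⟨i₁, hi₁⟩, hP⟩ := hx
  let p : ι ⊕ {i // P i} → ι ⊕ I := Sum.map id Subtype.val
  let q : {i // ¬ P i} → ι ⊕ I := Sum.inr ∘ Subtype.val
  have hpq : ∀ i, i ∈ Set.range p ∨ i ∈ Set.range q := by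
    rintro (j | i)
    · exact Or.inl ⟨Sum.inl j, rfl⟩
    · by_cases hi : P i
      · exact Or.inl ⟨Sum.inr ⟨i, hi⟩, rfl⟩
      · exact Or.inr ⟨⟨i, hi⟩, rfl⟩
  have hsep : Separated L r (Sum.elim z x) p q := by
    rintro j ⟨i, hi⟩
    refine hP i hi _ fun i' hi' => ?_
    rcases j with j | ⟨j, hj⟩
    · cases hi'
    · cases hi'; exact hj
  let S : ∀ {Y : Type} [L.Structure Y], (ι → Y) → (({i // P i}) → Y) → Prop :=
    fun {Y} _ w y => Sim L r (Sum.elim w y) (Sum.elim z fun i : {i // P i} => x i)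
  -- The entries indexed by `ι` are kept, although unlinked to this part, since the induction
  -- hypothesis counts extensions of `a` and `b`.
  let T : ∀ {Y : Type} [L.Structure Y], (ι → Y) → (({i // ¬ P i}) → Y) → Prop :=
    fun {Y} _ w y => Sim L r (Sum.elim w y) (Sum.elim z fun i : {i // ¬ P i} => x i)
  let Q : ∀ {Y : Type} [L.Structure Y], (ι → Y) → (I → Y) → Prop :=
    fun {Y} _ w y => S w (fun i => y i) ∧ T w (fun i => y i)
  have ep : ∀ {Y : Type} (w : ι → Y) (y : I → Y),
      Sum.elim w y ∘ p = Sum.elim w fun i : {i // P i} => y i := fun w y => by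
    funext j; rcases j with j | j <;> rfl
  have hQ : ∀ {Y : Type} [L.Structure Y] {w : ι → Y} {y : I → Y} {Y' : Type} [L.Structure Y']
      {w' : ι → Y'} {y' : I → Y'}, Sim L r (Sum.elim w y) (Sum.elim w' y') → Q w' y' → Q w y := by
    intro Y _ w y Y' _ w' y' hs hq
    refine ⟨Sim.trans ?_ hq.1, Sim.trans ?_ hq.2⟩
    · have := hs.comp le_rfl p
      rwa [ep, ep] at this
    · have := hs.comp le_rfl (Sum.map id Subtype.val : ι ⊕ {i // ¬ P i} → ι ⊕ I)
      rwa [Sum.elim_comp_map, Sum.elim_comp_map] at this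
  have hQx : Q z x := ⟨Sim.refl _ _, Sim.refl _ _⟩
  have hQcard : {c : I → A | Q a c}.ncard = {d : I → B | Q b d}.ncard := by
    have c1 : Nat.card {i // P i} < Nat.card I := Finite.card_subtype_lt hi₁
    have c2 : Nat.card {i // ¬ P i} < Nat.card I := Finite.card_subtype_lt (not_not.2 hP0)
    have : Nonempty {i // P i} := ⟨⟨i₀, hP0⟩⟩
    have : Nonempty {i // ¬ P i} := ⟨⟨i₁, hi₁⟩⟩
    rw [ncard_parts P (S a) (T a), ncard_parts P (S b) (T b)]
    congr 1
    · exact ihn hnR _ (by omega) z _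
    · exact ihn hnR _ (by omega) z _
  let W : Set (∀ (Y : Type) (_ : L.Structure Y), (ι ⊕ I → Y) → Prop) :=
    {τ | ∃ (Y : Type) (_ : L.Structure Y) (w : ι → Y) (y : I → Y),
      τ = sphereType L r (Sum.elim w y) ∧ Q w y ∧ ¬ Sim L r (Sum.elim w y) (Sum.elim z x)}
  have hW : ∀ {Y : Type} [L.Structure Y] (w : ι → Y) (y : I → Y),
      sphereType L r (Sum.elim w y) ∈ W ↔ Q w y ∧ ¬ Sim L r (Sum.elim w y) (Sum.elim z x) := by
    intro Y _ w y
    constructor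
    · rintro ⟨Y', _, w', y', he, hq, hs⟩
      rw [sphereType_eq_iff] at he
      exact ⟨hQ he hq, fun h' => hs (he.symm.trans h')⟩
    · rintro ⟨hq, hs⟩
      exact ⟨Y, _, w, y, rfl, hq, hs⟩
  have hWcard := ncard_preimage_eq (fun c : I → A => sphereType L r (Sum.elim a c))
    (fun d : I → B => sphereType L r (Sum.elim b d)) W (by
      rintro τ ⟨Y, _, w, y, rfl, hq, hs⟩
      simp only [sphereType_eq_iff]
      have h1 : Sim L r (Sum.elim z x ∘ p) (Sum.elim w y ∘ p) := by
        rw [ep, ep]; exact hq.1.symm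
      have h2 : Sim L r (Sum.elim z x ∘ q) (Sum.elim w y ∘ q) :=
        (hq.2.symm).comp le_rfl Sum.inr
      refine ihm _ (Set.ncard_lt_ncard ((Set.ssubset_iff_of_subset ?_).2 ?_)) w y rfl
      · intro ij hij hl
        exact hij (hsep.link_mono hpq h1 h2 hl)
      -- Without a new link `w, y` would be separated as well, and the isomorphisms of the parts
      -- would combine.
      · by_contra! hcon
        refine hs (Sim.symm (Sim.union hpq hsep ?_ h1 h2))
        intro i j hl
        exact hcon (p i, q j) (hsep i j) hl)
  simp only [hW] at hWcard
  have hadd : ∀ {Y : Type} [L.Structure Y] [Finite Y] (w : ι → Y),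
      {y : I → Y | Q w y}.ncard = {y : I → Y | Q w y ∧ ¬ Sim L r (Sum.elim w y) (Sum.elim z x)}.ncard
        + {y : I → Y | Sim L r (Sum.elim w y) (Sum.elim z x)}.ncard := by
    intro Y _ _ w
    exact (Set.ncard_sdiff_add_ncard_of_subset
      (s := {y | Sim L r (Sum.elim w y) (Sum.elim z x)}) fun y hy => hQ hy hQx).symm
  rw [hadd a, hadd b, hWcard] at hQcard
  exact Nat.add_left_cancel hQcard

-- Extending a matching by several elements

/-- Families with isomorphic `3 r + 1`-spheres in structures with the same numbers of `r`-spheres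
are matched. -/
theorem Sim.exists_matches [Finite A] [Finite B] {r : ℕ} {x : ι → A} {y : ι → B}
    (h : Sim L (3 * r + 1) x y) {f : A ≃ B}
    (hf : ∀ e, Sim L r (fun _ : Unit => e) (fun _ : Unit => f e)) :
    ∃ g : A ≃ B, Matches L r x y g := by
  classical
  obtain ⟨e, he⟩ := h
  have hwithin : ∀ {c}, c ∈ nbhd L (2 * r + 1) x → e c ∈ nbhd L (2 * r + 1) y :=
    fun ⟨i, hi⟩ => ⟨i, he.within (by omega) hi⟩
  have hwithin' : ∀ {c}, c ∈ nbhd L (2 * r + 1) y → e.symm c ∈ nbhd L (2 * r + 1) x :=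
    fun ⟨i, hi⟩ => ⟨i, he.symm.within (by omega) hi⟩
  have hs : nbhd L (2 * r + 1) x ⊆ e.source := fun c ⟨i, hi⟩ => by
    rw [he.source_eq]; exact ⟨i, hi.mono (by omega)⟩
  have ht : nbhd L (2 * r + 1) y ⊆ e.target := fun c ⟨i, hi⟩ => by
    rw [he.target_eq]; exact ⟨i, hi.mono (by omega)⟩
  -- Elements within `2 * r + 1` of the centre have their `r`-sphere inside the `3 * r + 1`-sphere,
  -- so `e` itself matches them.
  let e₁ : {c // c ∈ nbhd L (2 * r + 1) x} ≃ {c // c ∈ nbhd L (2 * r + 1) y} :=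
    { toFun := fun c => ⟨e c, hwithin c.2⟩
      invFun := fun c => ⟨e.symm c, hwithin' c.2⟩
      left_inv := fun c => Subtype.ext (e.left_inv (hs c.2))
      right_inv := fun c => Subtype.ext (e.right_inv (ht c.2)) }
  have h₁ : ∀ c : {c // c ∈ nbhd L (2 * r + 1) x},
      Sim L r (Sum.elim x fun _ : Unit => c.1) (Sum.elim y fun _ : Unit => (e₁ c).1) := by
    rintro ⟨c, j, hj⟩
    obtain ⟨e', he', -⟩ := he.restrict (w := Sum.elim x fun _ : Unit => c) (n := 2 * r + 1)
      (s := r) (by omega) (by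
        rintro (i | i)
        · exact ⟨i, within_refl _ _⟩
        · exact ⟨j, hj⟩)
    refine ⟨e', ?_⟩
    convert he' using 1
    funext i
    rcases i with i | i
    · exact (he.map_center i).symm
    · rfl
  let t : A → _ := fun c => sphereType L r fun _ : Unit => c
  let t' : B → _ := fun c => sphereType L r fun _ : Unit => c
  -- Subtracting the near elements from the totals leaves equally many far elements of each type.
  -- Far elements are not linked to the centre, so only their own spheres matter.
  obtain ⟨e₂, h₂⟩ : ∃ e₂ : {c // c ∉ nbhd L (2 * r + 1) x} ≃ {c // c ∉ nbhd L (2 * r + 1) y},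
      ∀ c, t' (e₂ c) = t c := by
    refine exists_equiv_of_card_fiber_eq (fun c : {c // c ∉ nbhd L (2 * r + 1) x} => t c)
      (fun c : {c // c ∉ nbhd L (2 * r + 1) y} => t' c) fun τ => ?_
    have hall := ncard_fiber_eq_of_equiv (t := t) (t' := t') f
      (fun c => sphereType_eq_iff.2 (hf c).symm) τ
    have hnear := ncard_fiber_eq_of_equiv
      (t := fun c : {c // c ∈ nbhd L (2 * r + 1) x} => t c)
      (t' := fun c : {c // c ∈ nbhd L (2 * r + 1) y} => t' c) e₁
      (fun c => sphereType_eq_iff.2 ((h₁ c).symm.comp le_rfl Sum.inr)) τ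
    have split : ∀ {Y : Type} [Finite Y] (s : Set Y)
        (t : Y → ∀ (X : Type) (_ : L.Structure X), (Unit → X) → Prop),
        {c | t c = τ}.ncard = {c : {c // c ∈ s} | t c = τ}.ncard +
          Nat.card {c : {c // c ∉ s} // t c = τ} := by
      intro Y _ s t
      have h1 : {c : {c // c ∈ s} | t c = τ}.ncard = ({c | t c = τ} ∩ s).ncard :=
        Nat.card_congr ((Equiv.subtypeSubtypeEquivSubtypeInter (· ∈ s) (fun c => t c = τ)).trans
          (Equiv.subtypeEquivRight fun c => and_comm))
      have h2 : Nat.card {c : {c // c ∉ s} // t c = τ} = ({c | t c = τ} \ s).ncard :=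
        Nat.card_congr ((Equiv.subtypeSubtypeEquivSubtypeInter (· ∉ s) (fun c => t c = τ)).trans
          (Equiv.subtypeEquivRight fun c => and_comm))
      rw [h1, h2, Set.ncard_inter_add_ncard_sdiff_eq_ncard]
    rw [split (nbhd L (2 * r + 1) x) t, split (nbhd L (2 * r + 1) y) t', hnear] at hall
    exact Nat.add_left_cancel hall
  refine ⟨(Equiv.sumCompl _).symm.trans ((Equiv.sumCongr e₁ e₂).trans (Equiv.sumCompl _)), ?_⟩
  intro c
  by_cases hc : c ∈ nbhd L (2 * r + 1) x
  · simpa [Equiv.sumCompl_symm_apply_of_pos hc] using h₁ ⟨c, hc⟩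
  · have hsim : Sim L r (fun _ : Unit => c) (fun _ : Unit => (e₂ ⟨c, hc⟩).1) :=
      sphereType_eq_iff.1 (h₂ ⟨c, hc⟩).symm
    have : Sim L r (Sum.elim x fun _ : Unit => c) (Sum.elim y fun _ : Unit => (e₂ ⟨c, hc⟩).1) := by
      refine Sim.union (f := Sum.inl) (g := Sum.inr) ?_ ?_ ?_ ?_ hsim
      · rintro (i | i)
        · exact Or.inl ⟨i, rfl⟩
        · exact Or.inr ⟨i, rfl⟩
      · exact fun i _ hl => hc ⟨i, hl.within⟩
      · exact fun i _ hl => (e₂ ⟨c, hc⟩).2 ⟨i, hl.within⟩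
      · exact Sim.comp ⟨e, he⟩ (by omega) id
    simpa [Equiv.sumCompl_symm_apply_of_neg hc] using this

/-- Families of `k` elements can be chosen at once: the radius shrinks by a factor linear in
`k`. -/
theorem Matches.extend [Finite A] [Finite B] [Finite ι] {R r : ℕ} {a : ι → A} {b : ι → B}
    {f : A ≃ B} (h : Matches L R a b f) (I : Type) [Finite I] [Nonempty I]
    (hR : (Nat.card I - 1) * (2 * (3 * r + 1) + 1) + (3 * r + 1) ≤ R) (c : I → A) :
    ∃ (d : I → B) (g : A ≃ B), Matches L r (Sum.elim a c) (Sum.elim b d) g := by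
  have hcard := h.ncard_eq (Nat.card I) hR I le_rfl a c
  have hpos : 0 < {d : I → B | Sim L (3 * r + 1) (Sum.elim b d) (Sum.elim a c)}.ncard := by
    rw [← hcard]
    exact (Set.ncard_pos).2 ⟨c, Sim.refl _ _⟩
  obtain ⟨d, hd⟩ := (Set.ncard_pos).1 hpos
  exact ⟨d, Sim.exists_matches hd.symm (f := f) fun e => (h e).comp (by omega) Sum.inr⟩

end Counting

-- Free variables and formula size

namespace FOFormula

variable {L : FirstOrder.Language.{u, v}} {A B : Type} [L.Structure A] [L.Structure B]
  {ι κ : Type}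

theorem realize_congr {φ : FOFormula L} {β γ : ℕ → A} (h : ∀ i ∈ φ.free, β i = γ i) :
    φ.Realize β ↔ φ.Realize γ := by
  induction φ generalizing β γ with
  | eq x y =>
    simp only [Realize]
    rw [h x (Or.inl rfl), h y (Or.inr rfl)]
  | rel R x =>
    simp only [Realize]
    have : (fun i => β (x i)) = fun i => γ (x i) := funext fun i => h _ ⟨i, rfl⟩
    rw [this]
  | neg φ ih => exact not_congr (ih h)
  | or φ ψ ih₁ ih₂ =>
    exact or_congr (ih₁ fun i hi => h i (Or.inl hi)) (ih₂ fun i hi => h i (Or.inr hi))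
  | ex y φ ih =>
    refine exists_congr fun a => ih fun i hi => ?_
    by_cases hiy : i = y
    · subst hiy; simp
    · simp [hiy, h i ⟨hi, hiy⟩]

theorem finite_free (φ : FOFormula L) : φ.free.Finite := by
  induction φ with
  | eq x y => exact Set.toFinite ({x, y} : Set ℕ)
  | rel R x => exact Set.finite_range _
  | neg φ ih => exact ih
  | or φ ψ ih₁ ih₂ => exact ih₁.union ih₂
  | ex y φ ih => exact ih.sdiff

theorem ncard_free_or_le (φ ψ : FOFormula L) :
    (or φ ψ).free.ncard ≤ φ.free.ncard + ψ.free.ncard := Set.ncard_union_le _ _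

/-- This is the inequality in `Witnessed` when no witnesses are used. -/
theorem ncard_free_le (φ : FOFormula L) : 2 * φ.free.ncard ≤ φ.size + 1 := by
  induction φ with
  | eq x y =>
    have : (eq x y : FOFormula L).free.ncard ≤ 2 := by
      simpa [free] using Set.ncard_insert_le x {y}
    simp only [size]; omega
  | @rel k R x =>
    have : (rel R x).free.ncard ≤ k := by
      have := Set.ncard_image_le (f := x) (s := Set.univ)
      simpa [free, ← Set.image_univ, Set.ncard_univ] using this
    simp only [size]; omega
  | neg φ ih => simp only [free, size]; omega
  | or φ ψ ih₁ ih₂ =>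
    have := ncard_free_or_le φ ψ
    simp only [size]; omega
  | ex y φ ih =>
    have : (ex y φ).free.ncard ≤ φ.free.ncard := Set.ncard_le_ncard Set.sdiff_subset φ.finite_free
    simp only [size]; omega

-- Witnesses of formulas

/-- The two families satisfy the same `Σ_n`-formulas of size at most `s`. -/
def Agree (L : FirstOrder.Language.{u, v}) [L.Structure A] [L.Structure B] (n s : ℕ)
    (a : ι → A) (b : ι → B) : Prop :=
  ∀ ψ : FOFormula L, ψ.IsSigma n → ψ.size ≤ s → ∀ w : ℕ → ι,
    ψ.Realize (a ∘ w) ↔ ψ.Realize (b ∘ w)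

theorem Agree.comp {n s : ℕ} {a : ι → A} {b : ι → B} (h : Agree L n s a b) (f : κ → ι) :
    Agree L n s (a ∘ f) (b ∘ f) := fun ψ hψ hs w => h ψ hψ hs (f ∘ w)

theorem Agree.elim_left {n s : ℕ} {a : ι → A} {b : ι → B} {c : κ → A} {d : κ → B}
    (h : Agree L n s (Sum.elim a c) (Sum.elim b d)) : Agree L n s a b := h.comp Sum.inl

theorem Agree.elim_comp {n s : ℕ} {a : ι → A} {b : ι → B} {c : κ → A} {d : κ → B}
    (h : Agree L n s (Sum.elim a c) (Sum.elim b d)) {κ' : Type} (f : κ' → κ) :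
    Agree L n s (Sum.elim a (c ∘ f)) (Sum.elim b (d ∘ f)) := by
  have := h.comp (Sum.map id f)
  rwa [Sum.elim_comp_map, Sum.elim_comp_map] at this

/-- Some few elements `c` of `A` guarantee property `p` of every family in `B` that, together with
some elements `d` of `B`, satisfies the same `Σ_n`-formulas. -/
def Witnessed (B : Type) [L.Structure B] (n s : ℕ) (φ : FOFormula L) (a : ι → A)
    (p : (ι → B) → Prop) : Prop :=
  ∃ (κ : Type) (_ : Finite κ), 4 * Nat.card κ + 2 * φ.free.ncard ≤ φ.size + 1 ∧
    ∃ c : κ → A, ∀ (b : ι → B) (d : κ → B), Agree L n s (Sum.elim a c) (Sum.elim b d) → p b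

theorem witnessed_of_agree {n s : ℕ} {φ : FOFormula L} {a : ι → A} {p : (ι → B) → Prop}
    (h : ∀ b, Agree L n s a b → p b) : Witnessed B n s φ a p := by
  refine ⟨Empty, inferInstance, ?_, Empty.elim, fun b d hd => h b hd.elim_left⟩
  simpa using φ.ncard_free_le

theorem comp_update (a : ι → A) (e : A) (w : ℕ → ι) (y : ℕ) :
    Sum.elim a (fun _ : Unit => e) ∘ Function.update (Sum.inl ∘ w) y (Sum.inr ()) =
      Function.update (a ∘ w) y e := by
  funext i
  by_cases hi : i = y
  · subst hi; simp
  · simp [hi]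

/-- A true `Σ_{n+1}`-formula and a false `Π_{n+1}`-formula have few witnesses. -/
theorem witnessed (n s : ℕ) (φ : FOFormula L) (hs : φ.size ≤ s) :
    (φ.sigmaDepth ≤ n + 1 → ∀ (ι : Type) (a : ι → A) (w : ℕ → ι), φ.Realize (a ∘ w) →
      Witnessed B n s φ a fun b => φ.Realize (b ∘ w)) ∧
    (φ.piDepth ≤ n + 1 → ∀ (ι : Type) (a : ι → A) (w : ℕ → ι), ¬ φ.Realize (a ∘ w) →
      Witnessed B n s φ a fun b => ¬ φ.Realize (b ∘ w)) := by
  -- A subformula already in $\Sigma_n$ is decided by agreement and needs no witness.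
  have base : ∀ φ : FOFormula L, φ.size ≤ s → φ.sigmaDepth ≤ n →
      (∀ (ι : Type) (a : ι → A) (w : ℕ → ι), φ.Realize (a ∘ w) →
        Witnessed B n s φ a fun b => φ.Realize (b ∘ w)) ∧
      (∀ (ι : Type) (a : ι → A) (w : ℕ → ι), ¬ φ.Realize (a ∘ w) →
        Witnessed B n s φ a fun b => ¬ φ.Realize (b ∘ w)) := fun φ hs hn =>
    ⟨fun ι a w h => witnessed_of_agree fun b hb => (hb φ hn hs w).1 h,
      fun ι a w h => witnessed_of_agree fun b hb => mt (hb φ hn hs w).2 h⟩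
  induction φ with
  | eq x y =>
    have := base _ hs (Nat.zero_le _)
    exact ⟨fun _ => this.1, fun _ => this.2⟩
  | rel R x =>
    have := base _ hs (Nat.zero_le _)
    exact ⟨fun _ => this.1, fun _ => this.2⟩
  | neg φ ih =>
    simp only [size] at hs
    obtain ⟨ih₁, ih₂⟩ := ih (by omega)
    constructor
    · intro hd ι a w h
      obtain ⟨κ, hκ, hc, c, hcd⟩ := ih₂ hd ι a w h
      exact ⟨κ, hκ, by simp only [size, free]; omega, c, hcd⟩
    · intro hd ι a w h
      obtain ⟨κ, hκ, hc, c, hcd⟩ := ih₁ hd ι a w (not_not.1 h)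
      exact ⟨κ, hκ, by simp only [size, free]; omega, c, fun b d hb => not_not.2 (hcd b d hb)⟩
  | or φ ψ ih₁ ih₂ =>
    simp only [size] at hs
    obtain ⟨ih₁, ih₁'⟩ := ih₁ (by omega)
    obtain ⟨ih₂, ih₂'⟩ := ih₂ (by omega)
    have hf := ncard_free_or_le φ ψ
    constructor
    · intro hd ι a w h
      simp only [sigmaDepth, max_le_iff] at hd
      rcases h with h | h
      · obtain ⟨κ, hκ, hc, c, hcd⟩ := ih₁ hd.1 ι a w h
        have := ψ.ncard_free_le
        exact ⟨κ, hκ, by simp only [size]; omega, c, fun b d hb => Or.inl (hcd b d hb)⟩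
      · obtain ⟨κ, hκ, hc, c, hcd⟩ := ih₂ hd.2 ι a w h
        have := φ.ncard_free_le
        exact ⟨κ, hκ, by simp only [size]; omega, c, fun b d hb => Or.inr (hcd b d hb)⟩
    · intro hd ι a w h
      simp only [piDepth, max_le_iff] at hd
      simp only [Realize, not_or] at h
      obtain ⟨κ₁, hκ₁, hc₁, c₁, hcd₁⟩ := ih₁' hd.1 ι a w h.1
      obtain ⟨κ₂, hκ₂, hc₂, c₂, hcd₂⟩ := ih₂' hd.2 ι a w h.2
      refine ⟨κ₁ ⊕ κ₂, inferInstance, ?_, Sum.elim c₁ c₂, fun b d hb => ?_⟩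
      · rw [Nat.card_sum]; simp only [size]; omega
      · simp only [Realize, not_or]
        exact ⟨hcd₁ b (d ∘ Sum.inl) (hb.elim_comp Sum.inl),
          hcd₂ b (d ∘ Sum.inr) (hb.elim_comp Sum.inr)⟩
  | ex y φ ih =>
    have hs' := hs
    simp only [size] at hs'
    constructor
    · intro hd ι a w h
      have hd' : φ.sigmaDepth ≤ n + 1 := le_trans (le_max_right _ _) hd
      obtain ⟨e, he⟩ := h
      by_cases hy : y ∈ φ.free
      · rw [← comp_update] at he
        obtain ⟨κ, hκ, hc, c, hcd⟩ := (ih (by omega)).1 hd' (ι ⊕ Unit) _ _ he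
        refine ⟨Unit ⊕ κ, inferInstance, ?_, Sum.elim (fun _ => e) c, fun b d hb => ?_⟩
        -- The quantifier adds 2 letters, and the loss of one free variable releases another 2;
        -- together they pay the 4 for the new witness.
        · have hf : (ex y φ).free.ncard + 1 = φ.free.ncard :=
            Set.ncard_sdiff_singleton_add_one hy φ.finite_free
          rw [Nat.card_sum]
          simp only [size, Nat.card_unique]
          omega
        · refine ⟨d (Sum.inl ()), ?_⟩
          rw [← comp_update]
          refine hcd _ (d ∘ Sum.inr) ?_
          have := hb.comp (Equiv.sumAssoc ι Unit κ)
          convert this using 1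
          · funext i; rcases i with (i | i) | i <;> rfl
          · funext i; rcases i with (i | i) | i <;> rfl
      -- A vacuous quantifier needs no witness; any element of `B` serves as its value.
      · have hup : ∀ {Y : Type} [L.Structure Y] (β : ℕ → Y) (e : Y),
            φ.Realize (Function.update β y e) ↔ φ.Realize β := fun β e =>
          realize_congr fun i hi =>
            Function.update_of_ne (fun h => hy (by rwa [← h])) _ _
        obtain ⟨κ, hκ, hc, c, hcd⟩ := (ih (by omega)).1 hd' ι a w ((hup _ e).1 he)
        refine ⟨κ, hκ, ?_, c, fun b d hb => ⟨b (w 0), (hup _ _).2 (hcd b d hb)⟩⟩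
        have hf : (ex y φ).free.ncard ≤ φ.free.ncard :=
          Set.ncard_le_ncard Set.sdiff_subset φ.finite_free
        simp only [size]; omega
    -- An existential formula in $\Pi_{n+1}$ is already in $\Sigma_n$.
    · intro hd
      exact (base _ hs (by simp only [piDepth] at hd; simp only [sigmaDepth]; omega)).2

theorem realize_iff_of_sim_zero {a : ι → A} {b : ι → B} (h : Sim L 0 a b) (φ : FOFormula L)
    (w : ℕ → ι) :
    (φ.sigmaDepth = 0 → (φ.Realize (a ∘ w) ↔ φ.Realize (b ∘ w))) ∧
      (φ.piDepth = 0 → (φ.Realize (a ∘ w) ↔ φ.Realize (b ∘ w))) := by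
  obtain ⟨e, he⟩ := h
  have hsrc : ∀ i, a i ∈ e.source := fun i => he.source_eq ▸ mem_nbhd_self 0 a i
  induction φ with
  | eq x y =>
    have : a (w x) = a (w y) ↔ b (w x) = b (w y) := by
      rw [← he.map_center, ← he.map_center]
      exact ⟨congrArg e, fun h => e.injOn (hsrc _) (hsrc _) h⟩
    exact ⟨fun _ => this, fun _ => this⟩
  | rel R x =>
    have : RelMap R (fun i => a (w (x i))) ↔ RelMap R (fun i => b (w (x i))) := by
      rw [← he.preservesRel _ R _ fun i => hsrc _]
      have : (e ∘ fun i => a (w (x i))) = fun i => b (w (x i)) :=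
        funext fun i => he.map_center _
      rw [this]
    exact ⟨fun _ => this, fun _ => this⟩
  | neg φ ih => exact ⟨fun hd => not_congr (ih.2 hd), fun hd => not_congr (ih.1 hd)⟩
  | or φ ψ ih₁ ih₂ =>
    constructor
    · intro hd
      simp only [sigmaDepth, Nat.max_eq_zero_iff] at hd
      exact or_congr (ih₁.1 hd.1) (ih₂.1 hd.2)
    · intro hd
      simp only [piDepth, Nat.max_eq_zero_iff] at hd
      exact or_congr (ih₁.2 hd.1) (ih₂.2 hd.2)
  | ex y φ ih => simp [sigmaDepth, piDepth]

/-- The radius suffices to choose `k` elements at once. -/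
theorem radius_bound {k s M : ℕ} (hk : 1 ≤ k) (hks : 3 * k ≤ s + 2) (hM : 1 ≤ M) :
    (k - 1) * (2 * (3 * (M - 1) + 1) + 1) + (3 * (M - 1) + 1) ≤ M * (2 * s + 1) - 1 := by
  obtain ⟨k, rfl⟩ := Nat.exists_eq_add_of_le hk
  obtain ⟨M, rfl⟩ := Nat.exists_eq_add_of_le hM
  -- In the original variables, the left side plus one is at most $M(6k-3)\le M(2s+1)$.
  have h1 : (1 + M) * (6 * k + 3) ≤ (1 + M) * (2 * s + 1) := Nat.mul_le_mul_left _ (by omega)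
  have h2 : k * (2 * (3 * M + 1) + 1) + (3 * M + 1) + 1 ≤ (1 + M) * (6 * k + 3) := by nlinarith
  simp only [Nat.add_sub_cancel_left]
  omega

/-- Induction on `n`: witnesses in one structure are answered in the other by `Matches.extend`, and
the matching that results has the radius for `n`. The converse follows from the inverse matching. -/
theorem agree_of_matches (n s : ℕ) {A B : Type} [L.Structure A] [L.Structure B] [Finite A]
    [Finite B] {ι : Type} [Finite ι] {a : ι → A} {b : ι → B} {f : A ≃ B}
    (h : Matches L ((2 * s + 1) ^ n - 1) a b f) : Agree L n s a b := by
  induction n generalizing A B ι with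
  | zero =>
    intro φ hφ _ w
    exact (realize_iff_of_sim_zero ((h (a (w 0))).comp le_rfl Sum.inl) φ w).1 (Nat.le_zero.1 hφ)
  | succ n ih =>
    have one_way : ∀ {A B : Type} [L.Structure A] [L.Structure B] [Finite A] [Finite B]
        {a : ι → A} {b : ι → B} {f : A ≃ B}, Matches L ((2 * s + 1) ^ (n + 1) - 1) a b f →
        ∀ φ : FOFormula L, φ.IsSigma (n + 1) → φ.size ≤ s → ∀ w : ℕ → ι,
          φ.Realize (a ∘ w) → φ.Realize (b ∘ w) := by
      intro A B _ _ _ _ a b f h φ hφ hs w hw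
      obtain ⟨κ, _, hκ, c, hc⟩ := (witnessed (B := B) n s φ hs).1 hφ ι a w hw
      have hM : 1 ≤ (2 * s + 1) ^ n := Nat.one_le_pow _ _ (by omega)
      rw [pow_succ] at h
      have hsize : 3 ≤ φ.size + 2 := by cases φ <;> simp only [size] <;> omega
      rcases isEmpty_or_nonempty κ with hκ' | hκ'
      -- Without witnesses a dummy element is added, only to shrink the radius, and then forgotten.
      · obtain ⟨d, g, hg⟩ := h.extend (r := (2 * s + 1) ^ n - 1) Unit
          (radius_bound (by simp) (by simp only [Nat.card_unique]; omega) hM) fun _ => a (w 0)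
        refine hc b isEmptyElim ?_
        convert (ih hg).elim_comp (isEmptyElim : κ → Unit)
      · have hpos : 0 < Nat.card κ := Nat.card_pos
        obtain ⟨d, g, hg⟩ := h.extend (r := (2 * s + 1) ^ n - 1) κ
          (radius_bound hpos (by omega) hM) c
        exact hc b d (ih hg)
    exact fun φ hφ hs w => ⟨one_way h φ hφ hs w, one_way h.symm φ hφ hs w⟩

end FOFormula

-- Translation to the original definitions

open Classical in
theorem SphereIso.sim {L : FirstOrder.Language.{u, v}} [L.IsRelational] {A B : Type}
    [L.Structure A] [L.Structure B] [Nonempty A] [Nonempty B] {k r : ℕ} {a : Fin k → A}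
    {b : Fin k → B} (h : SphereIso L r a b) : Sim L r a b := by
  obtain ⟨e, he⟩ := h
  have hA : ∀ c, c ∈ sphere L r a ↔ c ∈ nbhd L r a := fun c => Iff.rfl
  have hB : ∀ c, c ∈ sphere L r b ↔ c ∈ nbhd L r b := fun c => Iff.rfl
  let F : PartialEquiv A B :=
    -- The values outside of the spheres are irrelevant.
    { toFun := fun c => if hc : c ∈ sphere L r a then e ⟨c, hc⟩ else Classical.arbitrary B
      invFun := fun c => if hc : c ∈ sphere L r b then e.symm ⟨c, hc⟩ else Classical.arbitrary A
      source := nbhd L r a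
      target := nbhd L r b
      map_source' := fun c hc => by
        rw [← hA] at hc
        rw [dif_pos hc]
        exact (e ⟨c, hc⟩).2
      map_target' := fun c hc => by
        rw [← hB] at hc
        rw [dif_pos hc]
        exact (e.symm ⟨c, hc⟩).2
      left_inv' := fun c hc => by
        rw [← hA] at hc
        simp [hc]
      right_inv' := fun c hc => by
        rw [← hB] at hc
        simp [hc] }
  have hF : ∀ c : sphere L r a, F c = e c := fun c => dif_pos c.2
  refine ⟨F, rfl, rfl, ?_, fun i => ?_⟩
  · intro n R t ht
    let t' : Fin n → sphere L r a := fun i => ⟨t i, ht i⟩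
    have h1 : F ∘ t = fun i => ((e ∘ t') i : B) := funext fun i => hF (t' i)
    rw [h1]
    exact e.map_rel R t'
  · have := hF ⟨a i, mem_sphere L r a i⟩
    rw [he i] at this
    exact this

theorem REquivalent.exists_matches {L : FirstOrder.Language.{u, v}} [L.IsRelational] {A B : Type}
    [L.Structure A] [L.Structure B] [Nonempty A] [Nonempty B] {k r : ℕ} {a : Fin k → A}
    {b : Fin k → B} (h : REquivalent L r a b) : ∃ f : A ≃ B, Matches L r a b f := by
  obtain ⟨f, hf⟩ := h
  refine ⟨f, fun c => ?_⟩
  have := (hf c).sim.comp le_rfl (Sum.elim Fin.castSucc fun _ : Unit => Fin.last k)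
  convert this using 1
  · funext i; rcases i with i | i <;> simp
  · funext i; rcases i with i | i <;> simp

/-- Only free variables matter, and each is some `x j`, so assignments may take all their values in
the distinguished tuple, as `Agree` demands. -/
theorem FOFormula.satisfies_iff {L : FirstOrder.Language.{u, v}} {A : Type} [L.Structure A]
    {m : ℕ} {φ : FOFormula L} {x : Fin m → ℕ} (hfree : φ.free ⊆ Set.range x) {w : ℕ → Fin m}
    (hw : ∀ j, w (x j) = j) (a : Fin m → A) : φ.Satisfies x a ↔ φ.Realize (a ∘ w) := by
  constructor
  · rintro ⟨β, hβ, h⟩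
    refine (realize_congr fun i hi => ?_).1 h
    obtain ⟨j, rfl⟩ := hfree hi
    simp [hβ, hw]
  · exact fun h => ⟨a ∘ w, fun j => by simp [hw], h⟩

theorem FOFormula.isHanfLocalWith {L : FirstOrder.Language.{u, v}} [L.IsRelational] {n m : ℕ}
    (hm : 0 < m) {φ : FOFormula L} {x : Fin m → ℕ} (hx : Function.Injective x)
    (hfree : φ.free ⊆ Set.range x) (hφ : φ.IsSigma n) :
    φ.IsHanfLocalWith x ((2 * φ.size + 1) ^ n - 1) := by
  intro A B _ _ _ _ _ _ a b h
  have : Nonempty (Fin m) := ⟨⟨0, hm⟩⟩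
  obtain ⟨f, hf⟩ := h.exists_matches
  have hw : ∀ j, Function.invFun x (x j) = j := Function.leftInverse_invFun hx
  rw [satisfies_iff hfree hw, satisfies_iff hfree hw]
  exact agree_of_matches n φ.size hf φ hφ le_rfl _

end HanfLocality

theorem mainTheorem5 (L : FirstOrder.Language.{u, v}) [L.IsRelational] [Finite L.Symbols]
    [IsEmpty (L.Relations 0)] (n m : ℕ) (hm : 0 < m) (φ : HanfLocality.FOFormula L)
    (x : Fin m → ℕ) (hx : Function.Injective x) (hfree : φ.free ⊆ Set.range x)
    (hφ : φ.IsSigma n) :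
    φ.IsHanfLocal x ∧ φ.hanfLocalityRank x < (2 * φ.size + 1) ^ n := by
  have h := HanfLocality.FOFormula.isHanfLocalWith hm hx hfree hφ
  refine ⟨⟨_, h⟩, lt_of_le_of_lt (Nat.sInf_le h) ?_⟩
  exact Nat.sub_lt (Nat.pow_pos (Nat.succ_pos _)) one_pos
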